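/- \textbf{Corollary 5.} Let $[n]$ be a finite set of nodes and $\Theta=\{\theta_1,\dots,\theta_M\}$ a finite set of hypotheses, with true hypothesis $\theta_M$. Under hypothesis $\theta_k$ the joint observation profile $X=(X_1,\dots,X_n)\in\mathcal X_1\times\dots\times\mathcal X_n$ has joint law $f(\cdot;\theta_k)$, and node $i$ knows its local likelihood functions $f_i(\cdot;\theta_k)$, the densities of the $i$-th marginals of $f(\cdot;\theta_k)$, $k\in[M]$. The profiles $X^{(0)},X^{(1)},\dots$ are i.i.d. in time with law $f(\cdot;\theta_M)$ (possibly correlated across nodes); $\mathsf P$ is the law of this sequence. Assume that for every $k\ne j$ there is a node $i$ with $D(f_i(\cdot;\theta_k)\,\|\,f_i(\cdot;\theta_j))>0$. Let $W$ be a stochastic $n\times n$ matrix such that the directed graph with an edge from $j$ to $i$ iff $W_{ij}>0$ is strongly connected and aperiodic, and let $v$ be its stationary distribution, $v_i=\sum_j v_jW_{ji}$. Each node $i$ starts with a probability vector $q_i^{(0)}$ on $\Theta$ with $q_i^{(0)}(\theta_k)>0$ for all $k\in[M]$, and for $t=1,2,\dots$ \[ b_i^{(t)}(\theta_k)=\frac{f_i(X_i^{(t)};\theta_k)\,q_i^{(t-1)}(\theta_k)}{\sum_{a\in[M]}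 f_i(X_i^{(t)};\theta_a)\,q_i^{(t-1)}(\theta_a)},\qquad q_i^{(t)}(\theta_k)=\frac{\exp\big(\sum_{j} W_{ij}\log b_j^{(t)}(\theta_k)\big)}{\sum_{a\in[M]}\exp\big(\sum_{j} W_{ij}\log b_j^{(t)}(\theta_a)\big)} . \] Put $\rho_i^{(t)}(\theta_k)=-\frac1t\log q_i^{(t)}(\theta_k)$ and $K(\theta_M,\theta_k)=\sum_{i=1}^n v_i\,D(f_i(\cdot;\theta_M)\,\|\,f_i(\cdot;\theta_k))$. Suppose that for some constant $0<L<\infty$ \[ \max_{i\in[n]}\max_{j,k\in[M]}\sup_{x\in\mathcal X_i}\left|\log\frac{f_i(x;\theta_j)}{f_i(x;\theta_k)}\right|\le L . \] Then for every node $i$, every $k\in[M-1]$ and every $\epsilon>0$, \[ \limsup_{t\to\infty}\frac1t\log\mathsf P\big(\rho_i^{(t)}(\theta_k)\ge K(\theta_M,\theta_k)+\epsilon\big)\le-\frac{\epsilon^2}{2L^2} \quad\text{and}\quad \limsup_{t\to\infty}\frac1t\log\mathsf P\big(\rho_i^{(t)}(\theta_k)\le K(\theta_M,\theta_k)-\epsilon\big)\le-\frac{\epsilon^2}{2L^2},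 \] where $\log 0=-\infty$. -/

import Mathlib

open MeasureTheory Filter
open scoped ENNReal

namespace SocialLearning

/-- Observations of a finite network with node set `N`, hypotheses `Θ`, and observation space
`𝒳 i` at node `i`.  Under hypothesis `k` the joint observation profile has law `law k` (it may be
correlated across nodes); the local likelihood function `lik i k` of node `i` is a density of the
`i`-th marginal of `law k` with respect to a reference measure `ref i` that does not depend on `k`
(counting measure for discrete observations, Lebesgue measure for densities, ...). -/
structure ObservationModel (N Θ : Type*) (𝒳 : N → Type*) [∀ i, MeasurableSpace (𝒳 i)] where
  law : Θ → Measure (∀ i, 𝒳 i)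
  isProbabilityMeasure_law : ∀ k, IsProbabilityMeasure (law k)
  ref : ∀ i, Measure (𝒳 i)
  lik : ∀ i, Θ → 𝒳 i → ℝ
  measurable_lik : ∀ i k, Measurable (lik i k)
  lik_nonneg : ∀ i k x, 0 ≤ lik i k x
  map_law_eq : ∀ i k, (law k).map (fun x => x i) =
    (ref i).withDensity (fun x => ENNReal.ofReal (lik i k x))

namespace ObservationModel

variable {N Θ : Type*} {𝒳 : N → Type*} [∀ i, MeasurableSpace (𝒳 i)]

/-- The `i`-th marginal of the joint observation law under hypothesis `k`. -/
noncomputable def marginal (O : ObservationModel N Θ 𝒳) (i : N) (k : Θ) : Measure (𝒳 i) :=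
  (O.law k).map (fun x => x i)

/-- The law of the whole observation sequence `ω = (X⁽⁰⁾, X⁽¹⁾, …)`, i.i.d. in time with law
`law θ`, where `θ` is the true hypothesis. -/
noncomputable def pathMeasure (O : ObservationModel N Θ 𝒳) (θ : Θ) :
    Measure (ℕ → ∀ i, 𝒳 i) :=
  Measure.infinitePi (fun _ : ℕ => O.law θ)

/-- Every pair of distinct hypotheses is distinguished, in Kullback-Leibler divergence, by at least
one node. -/
def Distinguishable (O : ObservationModel N Θ 𝒳) : Prop :=
  ∀ k j : Θ, k ≠ j → ∃ i, 0 < InformationTheory.klDiv (O.marginal i k) (O.marginal i j)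

/-- All log-likelihood ratios are bounded by `L` in absolute value.  A ratio with exactly one of the
two likelihoods equal to zero has an infinite logarithm, so the likelihoods at a point are all
positive; points at which all of them vanish are outside the observation space. -/
def BoundedLogLikelihoodRatio (O : ObservationModel N Θ 𝒳) (L : ℝ) : Prop :=
  ∀ i x, (∃ a, O.lik i a x ≠ 0) →
    ∀ j k, 0 < O.lik i k x ∧ |Real.log (O.lik i j x / O.lik i k x)| ≤ L

/-- The network divergence `K(θ, k) = ∑ᵢ vᵢ D(fᵢ(·;θ) ‖ fᵢ(·;k))`. -/
noncomputable def networkDivergence [Fintype N] (O : ObservationModel N Θ 𝒳) (v : N → ℝ)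
    (θ k : Θ) : ℝ :=
  ∑ i, v i * (InformationTheory.klDiv (O.marginal i θ) (O.marginal i k)).toReal

/-- Local Bayesian update: the public beliefs formed from the private beliefs `q` and the
observation profile `x`. -/
noncomputable def publicUpdate [Fintype Θ] (O : ObservationModel N Θ 𝒳) (x : ∀ i, 𝒳 i)
    (q : N → Θ → ℝ) (i : N) (k : Θ) : ℝ :=
  O.lik i k (x i) * q i k / ∑ a, O.lik i a (x i) * q i a

end ObservationModel

/-- Averaging of log-beliefs: the private beliefs formed from the public beliefs `b`. -/
noncomputable def privateUpdate {N Θ : Type*} [Fintype N] [Fintype Θ] (W : Matrix N N ℝ)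
    (b : N → Θ → ℝ) (i : N) (k : Θ) : ℝ :=
  Real.exp (∑ j, W i j * Real.log (b j k)) / ∑ a, Real.exp (∑ j, W i j * Real.log (b j a))

namespace ObservationModel

variable {N Θ : Type*} {𝒳 : N → Type*} [∀ i, MeasurableSpace (𝒳 i)] [Fintype N] [Fintype Θ]

/-- The private beliefs at time `t` along the observation path `ω`, started at `q₀`; the step from
time `t` to time `t + 1` uses the observations `ω (t + 1)`. -/
noncomputable def privateBelief (O : ObservationModel N Θ 𝒳) (W : Matrix N N ℝ)
    (q₀ : N → Θ → ℝ) (ω : ℕ → ∀ i, 𝒳 i) : ℕ → N → Θ → ℝ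
  | 0 => q₀
  | t + 1 => privateUpdate W (O.publicUpdate (ω (t + 1)) (O.privateBelief W q₀ ω t))

/-- The rate of rejection `ρᵢ⁽ᵗ⁾(k) = -(1/t) log qᵢ⁽ᵗ⁾(k)`. -/
noncomputable def rejectionRate (O : ObservationModel N Θ 𝒳) (W : Matrix N N ℝ)
    (q₀ : N → Θ → ℝ) (i : N) (k : Θ) (t : ℕ) (ω : ℕ → ∀ i, 𝒳 i) : ℝ :=
  -(1 / (t : ℝ)) * Real.log (O.privateBelief W q₀ ω t i k)

end ObservationModel

/-- The directed graph of the network: there is an edge from `j` to `i` (so that `j` is a neighbour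
from which `i` receives messages) iff `W i j > 0`. -/
def networkGraph {N : Type*} (W : Matrix N N ℝ) : Digraph N where
  Adj j i := 0 < W i j

/-- Every node can be reached from every node along directed edges. -/
def IsStronglyConnected {N : Type*} (W : Matrix N N ℝ) : Prop :=
  ∀ j i : N, Relation.ReflTransGen (networkGraph W).Adj j i

/-- Every node has period one: the lengths `t ≥ 1` of the closed walks through it, i.e. those with
`(W ^ t) i i > 0`, have no common divisor other than one. -/
def IsAperiodic {N : Type*} [Fintype N] [DecidableEq N] (W : Matrix N N ℝ) : Prop :=
  ∀ i : N, ∀ d : ℕ, (∀ t : ℕ, 0 < t → 0 < (W ^ t) i i → d ∣ t) → d = 1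

/-- `v` is the stationary distribution of `W`: the normalized left eigenvector with eigenvalue one
(the eigenvector centrality). -/
def IsStationary {N : Type*} [Fintype N] (W : Matrix N N ℝ) (v : N → ℝ) : Prop :=
  v ∈ stdSimplex ℝ N ∧ ∀ i, v i = ∑ j, v j * W j i

/-- `(1/t) log p`, with value `-∞` for `p = 0` and `t ≥ 1`. -/
noncomputable def logRate (t : ℕ) (p : ℝ≥0∞) : EReal :=
  ((1 / (t : ℝ) : ℝ) : EReal) * ENNReal.log p

end SocialLearning

namespace SocialLearning

/-! ### Irreducible stochastic matrices. -/

section Stochastic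

variable {N : Type*} [Fintype N] [DecidableEq N] {W : Matrix N N ℝ}

/-! Normalisations cancel in a difference of log-beliefs, so these differences obey the linear
recursion `x (t + 1) = W (a (t + 1) + x t)`, driven by the log-likelihood ratios `a`. Unrolled, `x
t` is a bounded term plus a sum of independent terms `W ^ (t + 1 - s) a s`, each coordinate in `[-L,
L]` because powers of `W` average. Hoeffding gives tails `exp (-u ^ 2 / (2 t L ^ 2))` around the
mean, and the Poisson equation bounds the mean by `t` times a difference of network divergences,
plus a constant.

To pass from ratios to a single belief: if `k` is rejected too slowly, compare it with the truth,
whose belief is at most 1. If `k` is rejected too fast, some hypothesis has belief at least `1 /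
card Θ`; compare with that one and take a union bound over it. Constants and the factor `card Θ`
vanish in the exponential rate. -/

theorem abs_mulVec_le_of_mem_rowStochastic (hW : W ∈ Matrix.rowStochastic ℝ N) {x : N → ℝ} {C : ℝ}
    (hx : ∀ j, |x j| ≤ C) (i : N) : |(W.mulVec x) i| ≤ C := by
  calc |(W.mulVec x) i| ≤ ∑ j, |W i j * x j| := Finset.abs_sum_le_sum_abs _ _
    _ ≤ ∑ j, W i j * C := by
        refine Finset.sum_le_sum fun j _ => ?_
        rw [abs_mul, abs_of_nonneg (hW.1 i j)]
        exact mul_le_mul_of_nonneg_left (hx j) (hW.1 i j)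
    _ = C := by rw [← Finset.sum_mul, Matrix.sum_row_of_mem_rowStochastic hW, one_mul]

theorem abs_pow_mulVec_le_sum_abs (hW : W ∈ Matrix.rowStochastic ℝ N) (x : N → ℝ) (t : ℕ) (i : N) :
    |((W ^ t).mulVec x) i| ≤ ∑ j, |x j| :=
  abs_mulVec_le_of_mem_rowStochastic (pow_mem hW t)
    (fun j => Finset.single_le_sum (f := fun j => |x j|) (fun _ _ => abs_nonneg _)
      (Finset.mem_univ j)) i

/-- Harmonic vectors of an irreducible stochastic matrix are constant. -/
theorem eq_of_mulVec_eq_self (hW : W ∈ Matrix.rowStochastic ℝ N) (hconn : IsStronglyConnected W)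
    {z : N → ℝ} (hz : W.mulVec z = z) (i j : N) : z i = z j := by
  have : Nonempty N := ⟨i⟩
  obtain ⟨m, hm⟩ := Finite.exists_max z
  suffices h : ∀ l, z l = z m by rw [h i, h j]
  intro l
  -- Maximum principle: at a maximiser `c`, `z c` is a weighted average of values at most `z m`, so
  -- every in-neighbour of `c` is a maximiser too.
  refine Relation.ReflTransGen.head_induction_on (motive := fun l _ => z l = z m)
    (hconn l m) rfl fun {a c} hac _ hc => ?_
  have hac : 0 < W c a := hac
  have hsum : ∑ b, W c b * (z m - z b) = 0 := by
    have h1 : ∑ b, W c b * z b = z c := congrFun hz c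
    simp only [mul_sub, Finset.sum_sub_distrib, h1, ← Finset.sum_mul,
      Matrix.sum_row_of_mem_rowStochastic hW, one_mul, hc, sub_self]
  have h0 := (Finset.sum_eq_zero_iff_of_nonneg
    (fun b _ => mul_nonneg (hW.1 c b) (sub_nonneg.2 (hm b)))).1 hsum a (Finset.mem_univ a)
  rcases mul_eq_zero.1 h0 with h | h
  · exact absurd h hac.ne'
  · linarith

/-- The Poisson equation of an irreducible stochastic matrix is solvable. -/
theorem exists_poisson_solution (hW : W ∈ Matrix.rowStochastic ℝ N)
    (hconn : IsStronglyConnected W) {v : N → ℝ} (hv : IsStationary W v) (m : N → ℝ) :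
    ∃ y : N → ℝ, ∀ i, m i = v ⬝ᵥ m + (W.mulVec y) i - y i := by
  set T : (N → ℝ) →ₗ[ℝ] (N → ℝ) := W.mulVecLin - LinearMap.id with hT
  set φ : (N → ℝ) →ₗ[ℝ] ℝ := dotProductBilin ℝ ℝ v with hφ
  have hφ_apply : ∀ x, φ x = v ⬝ᵥ x := fun x => rfl
  have hvsum : v ⬝ᵥ (1 : N → ℝ) = 1 := by simpa [dotProduct] using hv.1.2
  have hvW : Matrix.vecMul v W = v := by
    ext i
    exact (hv.2 i).symm
  have hle : LinearMap.range T ≤ LinearMap.ker φ := by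
    rintro _ ⟨x, rfl⟩
    rw [LinearMap.mem_ker, hφ_apply]
    simp [hT, dotProduct_sub, Matrix.dotProduct_mulVec, hvW]
  have hker : LinearMap.ker T ≤ Submodule.span ℝ {(1 : N → ℝ)} := by
    intro z hz
    have hz' : W.mulVec z = z := by
      simpa [hT, sub_eq_zero] using hz
    rw [Submodule.mem_span_singleton]
    rcases isEmpty_or_nonempty N with h | ⟨⟨i⟩⟩
    · exact ⟨0, Subsingleton.elim _ _⟩
    · refine ⟨z i, funext fun j => ?_⟩
      simpa using eq_of_mulVec_eq_self hW hconn hz' i j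
  -- Dimension count: the kernel of `W - 1` is at most a line, so its range has codimension at most
  -- one and fills the hyperplane `ker φ` containing it.
  have h1 : Module.finrank ℝ (LinearMap.ker T) ≤ 1 :=
    (Submodule.finrank_mono hker).trans (finrank_span_le_card _ |>.trans (by simp))
  have h2 := T.finrank_range_add_finrank_ker
  have h3 := φ.finrank_range_add_finrank_ker
  have h4 : LinearMap.range φ = ⊤ := by
    refine LinearMap.range_eq_top.2 fun c => ⟨c • 1, ?_⟩
    rw [map_smul, hφ_apply, hvsum, smul_eq_mul, mul_one]
  rw [h4, finrank_top, Module.finrank_self] at h3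
  have heq : LinearMap.range T = LinearMap.ker φ :=
    Submodule.eq_of_le_of_finrank_le hle (by omega)
  have hmem : m - (v ⬝ᵥ m) • (1 : N → ℝ) ∈ LinearMap.range T := by
    rw [heq, LinearMap.mem_ker, hφ_apply, dotProduct_sub, dotProduct_smul, hvsum]
    simp
  obtain ⟨y, hy⟩ := hmem
  refine ⟨y, fun i => ?_⟩
  have := congrFun hy i
  simp [hT] at this
  linarith

/-- Solution of the recursion `x (t + 1) = W (a (t + 1) + x t)`. -/
theorem eq_pow_mulVec_add_sum {x a : ℕ → N → ℝ}
    (h : ∀ t, x (t + 1) = W.mulVec (a (t + 1) + x t)) (t : ℕ) :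
    x t = (W ^ t).mulVec (x 0) + ∑ s ∈ Finset.Icc 1 t, (W ^ (t + 1 - s)).mulVec (a s) := by
  induction t with
  | zero => simp
  | succ t ih =>
    rw [h, Finset.sum_Icc_succ_top (by omega), Matrix.mulVec_add, ih, Matrix.mulVec_add,
      Matrix.mulVec_mulVec, ← pow_succ', Matrix.mulVec_sum]
    have : ∀ s ∈ Finset.Icc 1 t, W.mulVec ((W ^ (t + 1 - s)).mulVec (a s)) =
        (W ^ (t + 1 + 1 - s)).mulVec (a s) := by
      intro s hs
      rw [Matrix.mulVec_mulVec, ← pow_succ', Nat.succ_sub (m := t + 1)]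
      have := (Finset.mem_Icc.1 hs).2
      omega
    rw [Finset.sum_congr rfl this]
    simp only [Nat.add_sub_cancel_left, pow_one]
    abel

/-- Ergodic sums of an irreducible stochastic matrix stay at bounded distance from their
stationary value. -/
theorem exists_forall_sum_pow_mulVec_le (hW : W ∈ Matrix.rowStochastic ℝ N)
    (hconn : IsStronglyConnected W) {v : N → ℝ} (hv : IsStationary W v) (m : N → ℝ) :
    ∃ C : ℝ, ∀ (t : ℕ) (i : N), ∑ s ∈ Finset.Icc 1 t, ((W ^ (t + 1 - s)).mulVec m) i ≤ t * (v ⬝ᵥ m) + C := by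
  obtain ⟨y, hy⟩ := exists_poisson_solution hW hconn hv m
  have hm : m = (v ⬝ᵥ m) • (1 : N → ℝ) + W.mulVec y - y := by
    ext i
    simpa using hy i
  -- With constant input `m`, the Poisson solution telescopes the recursion; subtracting `W y` makes
  -- the trajectory start at 0.
  have hrec : ∀ t : ℕ, (((t + 1 : ℕ) : ℝ) * (v ⬝ᵥ m)) • (1 : N → ℝ) + (W ^ (t + 1 + 1)).mulVec y
      - W.mulVec y = W.mulVec (m + (((t : ℝ) * (v ⬝ᵥ m)) • (1 : N → ℝ)
        + (W ^ (t + 1)).mulVec y - W.mulVec y)) := by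
    intro t
    have h1 : W.mulVec m = (v ⬝ᵥ m) • (1 : N → ℝ) + W.mulVec (W.mulVec y) - W.mulVec y := by
      conv_lhs => rw [hm]
      rw [Matrix.mulVec_sub, Matrix.mulVec_add, Matrix.mulVec_smul,
        Matrix.one_vecMul_of_mem_rowStochastic hW]
    rw [Matrix.mulVec_add, h1, Matrix.mulVec_sub, Matrix.mulVec_add, Matrix.mulVec_smul,
      Matrix.one_vecMul_of_mem_rowStochastic hW, Matrix.mulVec_mulVec y W (W ^ (t + 1)),
      ← pow_succ']
    push_cast
    rw [add_mul, one_mul, add_smul]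
    abel
  refine ⟨(∑ j, |y j|) + ∑ j, |y j|, fun t i => ?_⟩
  have h := congrFun (eq_pow_mulVec_add_sum (W := W) (a := fun _ => m)
    (x := fun t : ℕ => ((t : ℝ) * (v ⬝ᵥ m)) • (1 : N → ℝ) + (W ^ (t + 1)).mulVec y
      - W.mulVec y) hrec t) i
  simp only [Nat.cast_zero, zero_mul, zero_smul, zero_add, pow_one, sub_self, Matrix.mulVec_zero,
    Finset.sum_apply, Pi.sub_apply, Pi.add_apply, Pi.smul_apply, Pi.one_apply, Pi.zero_apply, smul_eq_mul,
    mul_one] at h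
  rw [← h]
  have h1 := abs_le.1 (abs_pow_mulVec_le_sum_abs hW y (t + 1) i)
  have h2 := abs_le.1 (abs_pow_mulVec_le_sum_abs hW y 1 i)
  rw [pow_one] at h2
  linarith [h1.2, h2.1]

end Stochastic

/-! ### Hoeffding tails and exponential rates. -/

/-- Hoeffding's inequality for independent bounded functions of the coordinates of an i.i.d.
sequence. -/
theorem measure_sum_apply_ge_le {E : Type*} [MeasurableSpace E] (μ : Measure E)
    [IsProbabilityMeasure μ] {g : ℕ → E → ℝ} (hg : ∀ s, Measurable (g s)) {L : ℝ} (hL : 0 < L)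
    (hgL : ∀ s x, |g s x| ≤ L) (t : ℕ) {u : ℝ} (hu : 0 ≤ u) :
    Measure.infinitePi (fun _ : ℕ => μ)
        {ω | u ≤ ∑ s ∈ Finset.Icc 1 t, (g s (ω s) - ∫ x, g s x ∂μ)}
      ≤ ENNReal.ofReal (Real.exp (-u ^ 2 / (2 * t * L ^ 2))) := by
  set P := Measure.infinitePi (fun _ : ℕ => μ) with hP
  have hindep : ProbabilityTheory.iIndepFun (fun s (ω : ℕ → E) => g s (ω s) - ∫ x, g s x ∂μ) P :=
    ProbabilityTheory.iIndepFun_infinitePi (P := fun _ : ℕ => μ)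
      (X := fun s x => g s x - ∫ x, g s x ∂μ) fun s => (hg s).sub_const _
  have hsub : ∀ s ∈ Finset.Icc 1 t, ProbabilityTheory.HasSubgaussianMGF
      (fun ω : ℕ → E => g s (ω s) - ∫ x, g s x ∂μ) ((‖L - -L‖₊ / 2) ^ 2) P := by
    intro s _
    have hint : ∫ ω, g s (ω s) ∂P = ∫ x, g s x ∂μ := by
      conv_rhs => rw [← Measure.infinitePi_map_eval (fun _ : ℕ => μ) s]
      exact (integral_map (measurable_pi_apply s).aemeasurable (hg s).aestronglyMeasurable).symm
    have := ProbabilityTheory.hasSubgaussianMGF_of_mem_Icc (μ := P)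
      (X := fun ω : ℕ → E => g s (ω s)) (a := -L) (b := L)
      ((hg s).comp (measurable_pi_apply s)).aemeasurable
      (ae_of_all _ fun ω => abs_le.1 (hgL s (ω s)))
    rwa [hint] at this
  have h := ProbabilityTheory.HasSubgaussianMGF.measure_sum_ge_le_of_iIndepFun hindep hsub hu
  -- The range has length `2L`, so the sub-Gaussian variance proxy is `L ^ 2`.
  have hc : (((‖L - -L‖₊ / 2) ^ 2 : NNReal) : ℝ) = L ^ 2 := by
    push_cast
    rw [Real.norm_eq_abs, sub_neg_eq_add, ← two_mul, abs_mul, abs_of_pos hL]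
    norm_num
  rw [Finset.sum_const, Nat.card_Icc, Nat.add_sub_cancel, nsmul_eq_mul, NNReal.coe_mul, hc,
    NNReal.coe_natCast, ← mul_assoc] at h
  rw [← ofReal_measureReal]
  exact ENNReal.ofReal_le_ofReal h

theorem limsup_logRate_le {p : ℕ → ℝ≥0∞} {M C ε L : ℝ} (hM : 0 < M)
    (hp : ∀ᶠ t : ℕ in atTop, p t ≤ ENNReal.ofReal
      (M * Real.exp (-(t * ε - C) ^ 2 / (2 * t * L ^ 2)))) :
    limsup (fun t => logRate t (p t)) atTop ≤ ((-(ε ^ 2 / (2 * L ^ 2)) : ℝ) : EReal) := by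
  have hlim : Tendsto (fun t : ℕ => (Real.log M / t - (ε - C / t) ^ 2 / (2 * L ^ 2) : ℝ)) atTop
      (nhds (0 - (ε - 0) ^ 2 / (2 * L ^ 2))) :=
    (tendsto_const_div_atTop_nhds_zero_nat _).sub
      (((tendsto_const_nhds.sub (tendsto_const_div_atTop_nhds_zero_nat _)).pow 2).div_const _)
  rw [sub_zero, zero_sub] at hlim
  have hlim' := (continuous_coe_real_ereal.tendsto _).comp hlim
  rw [← hlim'.limsup_eq]
  refine limsup_le_limsup ?_
  filter_upwards [hp, eventually_gt_atTop 0] with t ht ht0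
  have ht0' : (0 : ℝ) < t := Nat.cast_pos.2 ht0
  calc logRate t (p t)
      ≤ ((1 / (t : ℝ) : ℝ) : EReal) * ENNReal.log (ENNReal.ofReal
          (M * Real.exp (-(t * ε - C) ^ 2 / (2 * t * L ^ 2)))) :=
        mul_le_mul_of_nonneg_left (ENNReal.log_le_log ht) (by positivity)
    _ = _ := by
        rw [ENNReal.log_ofReal_of_pos (by positivity), Real.log_mul hM.ne' (Real.exp_ne_zero _),
          Real.log_exp, ← EReal.coe_mul, Function.comp_apply]
        congr 1
        -- For `L = 0` both quotients are 0 by the division convention.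
        rcases eq_or_ne L 0 with rfl | hL
        · simp; ring
        · field_simp; ring

/-! ### Log-likelihood ratios and divergences. -/

namespace ObservationModel

variable {N Θ : Type*} {𝒳 : N → Type*} [∀ i, MeasurableSpace (𝒳 i)]
  {O : ObservationModel N Θ 𝒳} {L : ℝ}

/-- The vector of local log-likelihood ratios of hypotheses `a` and `k` at a profile `x`. -/
noncomputable def logLikRatio (O : ObservationModel N Θ 𝒳) (a k : Θ) (x : ∀ i, 𝒳 i) (i : N) : ℝ :=
  Real.log (O.lik i a (x i) / O.lik i k (x i))

theorem measurable_logLikRatio (O : ObservationModel N Θ 𝒳) (a k : Θ) (i : N) :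
    Measurable fun x => O.logLikRatio a k x i :=
  (((O.measurable_lik i a).comp (measurable_pi_apply i)).div
    ((O.measurable_lik i k).comp (measurable_pi_apply i))).log

theorem BoundedLogLikelihoodRatio.abs_logLikRatio_le (h : O.BoundedLogLikelihoodRatio L)
    (hL : 0 < L) (a k : Θ) (x : ∀ i, 𝒳 i) (i : N) : |O.logLikRatio a k x i| ≤ L := by
  -- Where the numerator vanishes, `Real.log 0 = 0` keeps the bound valid everywhere, not just
  -- almost everywhere.
  by_cases hx : O.lik i a (x i) = 0
  · simp [logLikRatio, hx, hL.le]
  · exact (h i (x i) ⟨a, hx⟩ a k).2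

theorem isProbabilityMeasure_marginal (O : ObservationModel N Θ 𝒳) (i : N) (k : Θ) :
    IsProbabilityMeasure (O.marginal i k) :=
  have := O.isProbabilityMeasure_law k
  Measure.isProbabilityMeasure_map (measurable_pi_apply i).aemeasurable

/-- A marginal does not charge the zeros of its own density, and off them boundedness makes all
likelihoods positive. -/
theorem BoundedLogLikelihoodRatio.ae_lik_pos (h : O.BoundedLogLikelihoodRatio L) (i : N) (θ : Θ) :
    ∀ᵐ x ∂O.marginal i θ, ∀ k, 0 < O.lik i k x := by
  rw [marginal, O.map_law_eq, ae_withDensity_iff (O.measurable_lik i θ).ennreal_ofReal]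
  refine ae_of_all _ fun x hx k => (h i x ⟨θ, fun h0 => hx ?_⟩ k k).1
  rw [h0, ENNReal.ofReal_zero]

theorem BoundedLogLikelihoodRatio.marginal_eq_withDensity (h : O.BoundedLogLikelihoodRatio L)
    (i : N) (θ k : Θ) : O.marginal i θ =
      (O.marginal i k).withDensity fun x => ENNReal.ofReal (O.lik i θ x / O.lik i k x) := by
  rw [marginal, marginal, O.map_law_eq, O.map_law_eq]
  refine Eq.trans ?_ (withDensity_mul _ (O.measurable_lik i k).ennreal_ofReal
    ((O.measurable_lik i θ).div (O.measurable_lik i k)).ennreal_ofReal)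
  congr 1
  ext x
  rw [Pi.mul_apply, ← ENNReal.ofReal_mul (O.lik_nonneg i k x)]
  by_cases hx : O.lik i θ x = 0
  · simp [hx]
  · rw [mul_div_cancel₀ _ (h i x ⟨θ, hx⟩ k k).1.ne']

theorem BoundedLogLikelihoodRatio.toReal_klDiv_marginal (h : O.BoundedLogLikelihoodRatio L)
    (i : N) (θ k : Θ) : (InformationTheory.klDiv (O.marginal i θ) (O.marginal i k)).toReal =
      ∫ x, Real.log (O.lik i θ x / O.lik i k x) ∂O.marginal i θ := by
  have := O.isProbabilityMeasure_marginal i θ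
  have := O.isProbabilityMeasure_marginal i k
  have hd := h.marginal_eq_withDensity i θ k
  have hac : O.marginal i θ ≪ O.marginal i k := by
    rw [hd]
    exact withDensity_absolutelyContinuous _ _
  rw [InformationTheory.toReal_klDiv_of_measure_eq hac (by simp)]
  refine integral_congr_ae ?_
  have hr : ((O.marginal i k).withDensity fun x =>
      ENNReal.ofReal (O.lik i θ x / O.lik i k x)).rnDeriv
      (O.marginal i k) =ᵐ[O.marginal i k] fun x => ENNReal.ofReal (O.lik i θ x / O.lik i k x) :=
    Measure.rnDeriv_withDensity _ ((O.measurable_lik i θ).div (O.measurable_lik i k)).ennreal_ofReal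
  rw [← hd] at hr
  filter_upwards [hac.ae_le hr] with x hx
  rw [llr, hx, ENNReal.toReal_ofReal (div_nonneg (O.lik_nonneg i θ x) (O.lik_nonneg i k x))]

/-- Almost surely `log (a / k) = log (θ / k) - log (θ / a)`, and each term integrates to a
divergence. -/
theorem BoundedLogLikelihoodRatio.integral_logLikRatio (h : O.BoundedLogLikelihoodRatio L)
    (hL : 0 < L) (i : N) (θ a k : Θ) : ∫ x, O.logLikRatio a k x i ∂O.law θ =
      (InformationTheory.klDiv (O.marginal i θ) (O.marginal i k)).toReal -
      (InformationTheory.klDiv (O.marginal i θ) (O.marginal i a)).toReal := by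
  have := O.isProbabilityMeasure_law θ
  have hmeas : ∀ b c, Measurable fun x => Real.log (O.lik i b x / O.lik i c x) := fun b c =>
    ((O.measurable_lik i b).div (O.measurable_lik i c)).log
  have hmap : ∀ b c, ∫ x, Real.log (O.lik i b x / O.lik i c x) ∂O.marginal i θ =
      ∫ x, O.logLikRatio b c x i ∂O.law θ := fun b c =>
    integral_map (measurable_pi_apply i).aemeasurable (hmeas b c).aestronglyMeasurable
  have hint : ∀ b c, Integrable (fun x => O.logLikRatio b c x i) (O.law θ) := fun b c =>
    Integrable.of_bound (O.measurable_logLikRatio b c i).aestronglyMeasurable L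
      (ae_of_all _ fun x => h.abs_logLikRatio_le hL b c x i)
  rw [h.toReal_klDiv_marginal, h.toReal_klDiv_marginal, hmap, hmap,
    ← integral_sub (hint _ _) (hint _ _)]
  refine integral_congr_ae ?_
  filter_upwards [ae_of_ae_map (measurable_pi_apply i).aemeasurable (h.ae_lik_pos i θ)] with x hx
  simp only [logLikRatio]
  rw [Real.log_div (hx _).ne' (hx _).ne', Real.log_div (hx _).ne' (hx _).ne',
    Real.log_div (hx _).ne' (hx _).ne']
  ring

theorem BoundedLogLikelihoodRatio.ae_path_lik_pos [Finite N] (h : O.BoundedLogLikelihoodRatio L)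
    (θ : Θ) : ∀ᵐ ω ∂O.pathMeasure θ, ∀ t i k, 0 < O.lik i k (ω t i) := by
  have := O.isProbabilityMeasure_law θ
  refine ae_all_iff.2 fun t => ae_all_iff.2 fun i => ?_
  have h1 : ∀ᵐ x ∂O.law θ, ∀ k, 0 < O.lik i k (x i) :=
    ae_of_ae_map (measurable_pi_apply i).aemeasurable (h.ae_lik_pos i θ)
  rw [← Measure.infinitePi_map_eval (fun _ : ℕ => O.law θ) t] at h1
  exact ae_of_ae_map (measurable_pi_apply t).aemeasurable h1

theorem networkDivergence_self [Fintype N] {v : N → ℝ} (θ : Θ) : O.networkDivergence v θ θ = 0 := by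
  have := fun i => O.isProbabilityMeasure_marginal i θ
  simp [networkDivergence]

theorem networkDivergence_nonneg [Fintype N] {W : Matrix N N ℝ} {v : N → ℝ} (hv : IsStationary W v) (θ k : Θ) :
    0 ≤ O.networkDivergence v θ k :=
  Finset.sum_nonneg fun i _ => mul_nonneg (hv.1.1 i) ENNReal.toReal_nonneg

/-! ### Belief dynamics and deviation bounds. -/

variable [Fintype N] [Fintype Θ] {W : Matrix N N ℝ} {q₀ : N → Θ → ℝ} {ω : ℕ → ∀ i, 𝒳 i}

theorem privateBelief_pos (hq₀ : ∀ i k, 0 < q₀ i k) (t : ℕ) (i : N) (k : Θ) :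
    0 < O.privateBelief W q₀ ω t i k := by
  cases t with
  | zero => exact hq₀ i k
  | succ t =>
    exact div_pos (Real.exp_pos _) (Finset.sum_pos (fun _ _ => Real.exp_pos _) ⟨k, Finset.mem_univ k⟩)

theorem sum_privateBelief [Nonempty Θ] (hq₀ : ∀ i, q₀ i ∈ stdSimplex ℝ Θ) (t : ℕ) (i : N) :
    ∑ k, O.privateBelief W q₀ ω t i k = 1 := by
  cases t with
  | zero => exact (hq₀ i).2
  | succ t =>
    simp only [privateBelief, privateUpdate]
    rw [← Finset.sum_div]
    exact div_self (Finset.sum_pos (fun _ _ => Real.exp_pos _) Finset.univ_nonempty).ne'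

/-- Log-belief ratios evolve linearly. -/
theorem log_privateBelief_succ_sub (hq₀ : ∀ i k, 0 < q₀ i k)
    (hω : ∀ t i k, 0 < O.lik i k (ω t i)) (a k : Θ) (t : ℕ) :
    (fun i => Real.log (O.privateBelief W q₀ ω (t + 1) i a) -
      Real.log (O.privateBelief W q₀ ω (t + 1) i k)) =
    W.mulVec (O.logLikRatio a k (ω (t + 1)) + fun i => Real.log (O.privateBelief W q₀ ω t i a) -
      Real.log (O.privateBelief W q₀ ω t i k)) := by
  ext i
  have hs : (∑ b, Real.exp (∑ j, W i j * Real.log (O.publicUpdate (ω (t + 1))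
      (O.privateBelief W q₀ ω t) j b))) ≠ 0 :=
    (Finset.sum_pos (fun _ _ => Real.exp_pos _) ⟨k, Finset.mem_univ k⟩).ne'
  simp only [privateBelief, privateUpdate]
  rw [Real.log_div (Real.exp_ne_zero _) hs, Real.log_div (Real.exp_ne_zero _) hs, Real.log_exp,
    Real.log_exp, sub_sub_sub_cancel_right, ← Finset.sum_sub_distrib]
  refine Finset.sum_congr rfl fun j _ => ?_
  rw [← mul_sub]
  congr 1
  have hq : ∀ b, 0 < O.privateBelief W q₀ ω t j b := fun b => privateBelief_pos hq₀ t j b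
  have hl := hω (t + 1) j
  have hd : (∑ b, O.lik j b (ω (t + 1) j) * O.privateBelief W q₀ ω t j b) ≠ 0 :=
    (Finset.sum_pos (fun b _ => mul_pos (hl b) (hq b)) ⟨k, Finset.mem_univ k⟩).ne'
  simp only [publicUpdate, Pi.add_apply, logLikRatio]
  rw [Real.log_div (mul_pos (hl a) (hq a)).ne' hd, Real.log_div (mul_pos (hl k) (hq k)).ne' hd,
    Real.log_mul (hl a).ne' (hq a).ne', Real.log_mul (hl k).ne' (hq k).ne',
    Real.log_div (hl a).ne' (hl k).ne']
  ring

variable [DecidableEq N]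

/-- Upper deviations of the log-belief ratio of `a` and `k` from its asymptotic drift. -/
theorem exists_measure_log_privateBelief_sub_ge_le (hW : W ∈ Matrix.rowStochastic ℝ N)
    (hconn : IsStronglyConnected W) {v : N → ℝ} (hv : IsStationary W v)
    (hq₀ : ∀ i k, 0 < q₀ i k) (hL : 0 < L) (h : O.BoundedLogLikelihoodRatio L) (i : N)
    (θ a k : Θ) :
    ∃ C : ℝ, ∀ (t : ℕ) (u : ℝ), 0 ≤ u → O.pathMeasure θ {ω |
        t * (O.networkDivergence v θ k - O.networkDivergence v θ a) + C + u ≤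
          Real.log (O.privateBelief W q₀ ω t i a) - Real.log (O.privateBelief W q₀ ω t i k)}
      ≤ ENNReal.ofReal (Real.exp (-u ^ 2 / (2 * t * L ^ 2))) := by
  have := O.isProbabilityMeasure_law θ
  set m : N → ℝ := fun j => ∫ x, O.logLikRatio a k x j ∂O.law θ with hm
  have hvm : v ⬝ᵥ m = O.networkDivergence v θ k - O.networkDivergence v θ a := by
    simp only [dotProduct, hm, h.integral_logLikRatio hL, networkDivergence, mul_sub,
      Finset.sum_sub_distrib]
  obtain ⟨C, hC⟩ := exists_forall_sum_pow_mulVec_le hW hconn hv m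
  -- The constant absorbs the Poisson error and the initial beliefs.
  refine ⟨C + ∑ j, |Real.log (q₀ j a) - Real.log (q₀ j k)|, fun t u hu => ?_⟩
  -- For `s > t` the truncated exponent is 0; these terms are still bounded and never enter the sum.
  set g : ℕ → (∀ i, 𝒳 i) → ℝ := fun s x => ((W ^ (t + 1 - s)).mulVec (O.logLikRatio a k x)) i
    with hg
  have hgm : ∀ s, Measurable (g s) := fun s =>
    Finset.measurable_sum _ fun j _ => (O.measurable_logLikRatio a k j).const_mul _
  have hgL : ∀ s x, |g s x| ≤ L := fun s x =>
    abs_mulVec_le_of_mem_rowStochastic (pow_mem hW _) (h.abs_logLikRatio_le hL a k x) i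
  have hgint : ∀ s, ∫ x, g s x ∂O.law θ = ((W ^ (t + 1 - s)).mulVec m) i := by
    intro s
    simp only [hg, Matrix.mulVec, dotProduct]
    rw [integral_finsetSum]
    · simp only [integral_const_mul, hm]
    · exact fun j _ => (Integrable.of_bound
        (O.measurable_logLikRatio a k j).aestronglyMeasurable L
        (ae_of_all _ fun x => h.abs_logLikRatio_le hL a k x j)).const_mul _
  refine (measure_mono_ae ?_).trans (measure_sum_apply_ge_le (O.law θ) hgm hL hgL t hu)
  filter_upwards [h.ae_path_lik_pos θ] with ω hω hmem
  have hmem : t * (O.networkDivergence v θ k - O.networkDivergence v θ a) +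
    (C + ∑ j, |Real.log (q₀ j a) - Real.log (q₀ j k)|) + u ≤
      Real.log (O.privateBelief W q₀ ω t i a) - Real.log (O.privateBelief W q₀ ω t i k) := hmem
  change u ≤ ∑ s ∈ Finset.Icc 1 t, (g s (ω s) - ∫ x, g s x ∂O.law θ)
  have hrec := congrFun (eq_pow_mulVec_add_sum (W := W)
    (x := fun t i => Real.log (O.privateBelief W q₀ ω t i a) -
      Real.log (O.privateBelief W q₀ ω t i k)) (a := fun s => O.logLikRatio a k (ω s))
    (log_privateBelief_succ_sub hq₀ hω a k) t) i
  rw [Pi.add_apply, Finset.sum_apply] at hrec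
  have h0 := abs_le.1 (abs_pow_mulVec_le_sum_abs hW
    (fun j => Real.log (q₀ j a) - Real.log (q₀ j k)) t i)
  have h1 := hC t i
  rw [hvm] at h1
  rw [Finset.sum_sub_distrib]
  simp only [hgint]
  simp only [privateBelief] at hrec
  simp only [hg]
  linarith [h0.2]

end ObservationModel

end SocialLearning

/-! ### From ratios to rejection rates. -/

open SocialLearning ObservationModel in
theorem corollary5 {N Θ : Type*} [Fintype N] [DecidableEq N] [Fintype Θ]
    {𝒳 : N → Type*} [∀ i, MeasurableSpace (𝒳 i)]
    (O : SocialLearning.ObservationModel N Θ 𝒳) (θM : Θ)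
    (W : Matrix N N ℝ) (v : N → ℝ) (q₀ : N → Θ → ℝ) (L : ℝ)
    (hdist : O.Distinguishable)
    (hW : W ∈ Matrix.rowStochastic ℝ N)
    (hconn : SocialLearning.IsStronglyConnected W)
    (haper : SocialLearning.IsAperiodic W)
    (hv : SocialLearning.IsStationary W v)
    (hq₀ : ∀ i, q₀ i ∈ stdSimplex ℝ Θ)
    (hq₀_pos : ∀ i k, 0 < q₀ i k)
    (hL : 0 < L)
    (hbdd : O.BoundedLogLikelihoodRatio L)
    (i : N) (k : Θ) (hk : k ≠ θM) (ε : ℝ) (hε : 0 < ε) :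
    limsup (fun t : ℕ => SocialLearning.logRate t (O.pathMeasure θM
        {ω | O.rejectionRate W q₀ i k t ω ≥ O.networkDivergence v θM k + ε})) atTop
      ≤ ((-(ε ^ 2 / (2 * L ^ 2)) : ℝ) : EReal) ∧
    limsup (fun t : ℕ => SocialLearning.logRate t (O.pathMeasure θM
        {ω | O.rejectionRate W q₀ i k t ω ≤ O.networkDivergence v θM k - ε})) atTop
      ≤ ((-(ε ^ 2 / (2 * L ^ 2)) : ℝ) : EReal) := by
  have hΘ : Nonempty Θ := ⟨θM⟩
  have hrate : ∀ (t : ℕ) (ω), 0 < t →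
      (t : ℝ) * O.rejectionRate W q₀ i k t ω = -Real.log (O.privateBelief W q₀ ω t i k) := by
    intro t ω ht
    have : (t : ℝ) ≠ 0 := Nat.cast_ne_zero.2 ht.ne'
    simp only [rejectionRate]
    field_simp
  have hlarge : ∀ C : ℝ, ∀ᶠ t : ℕ in atTop, C ≤ t * ε := fun C =>
    (tendsto_natCast_atTop_atTop.atTop_mul_const hε).eventually_ge_atTop C
  constructor
  · choose C hC using fun a => exists_measure_log_privateBelief_sub_ge_le hW hconn hv hq₀_pos hL
      hbdd i θM a k
    obtain ⟨B, hB⟩ := Finite.bddAbove_range C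
    have hcard : (0 : ℝ) < Fintype.card Θ := Nat.cast_pos.2 Fintype.card_pos
    refine limsup_logRate_le (M := Fintype.card Θ) (C := B + Real.log (Fintype.card Θ)) hcard ?_
    filter_upwards [eventually_gt_atTop 0, hlarge (B + Real.log (Fintype.card Θ))] with t ht htB
    set u : ℝ := t * ε - (B + Real.log (Fintype.card Θ)) with hu
    have hsub : {ω | O.rejectionRate W q₀ i k t ω ≥ O.networkDivergence v θM k + ε} ⊆
        ⋃ a, {ω | t * (O.networkDivergence v θM k - O.networkDivergence v θM a) + C a + u ≤
          Real.log (O.privateBelief W q₀ ω t i a) -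
            Real.log (O.privateBelief W q₀ ω t i k)} := by
      intro ω hω
      have hω : O.networkDivergence v θM k + ε ≤ O.rejectionRate W q₀ i k t ω := hω
      -- Pigeonhole: the index `a` depends on the path, hence the union.
      obtain ⟨a, -, ha⟩ := Finset.exists_le_of_sum_le (s := Finset.univ)
        (f := fun _ : Θ => 1 / (Fintype.card Θ : ℝ)) (g := O.privateBelief W q₀ ω t i)
        Finset.univ_nonempty (by
          rw [sum_privateBelief hq₀, Finset.sum_const, Finset.card_univ, nsmul_eq_mul,
            mul_one_div_cancel hcard.ne'])
      refine Set.mem_iUnion.2 ⟨a, ?_⟩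
      have h1 := Real.log_le_log (by positivity) ha
      rw [one_div, Real.log_inv] at h1
      have h2 := mul_le_mul_of_nonneg_left hω (Nat.cast_nonneg (α := ℝ) t)
      rw [hrate t ω ht] at h2
      -- A nonnegative divergence of `a` only lowers the drift, so the excess `t * ε` survives for
      -- every `a`.
      have h3 := mul_nonneg (Nat.cast_nonneg (α := ℝ) t)
        (networkDivergence_nonneg (O := O) hv θM a)
      have h4 : C a ≤ B := hB ⟨a, rfl⟩
      simp only [Set.mem_ofPred_eq, mul_sub]
      linarith
    calc O.pathMeasure θM _ ≤ _ := measure_mono hsub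
      _ ≤ ∑ a, _ := measure_iUnion_fintype_le _ _
      _ ≤ ∑ _a : Θ, ENNReal.ofReal (Real.exp (-u ^ 2 / (2 * t * L ^ 2))) :=
          Finset.sum_le_sum fun a _ => hC a t u (by linarith)
      _ = _ := by
          rw [Finset.sum_const, Finset.card_univ, nsmul_eq_mul, ENNReal.ofReal_mul hcard.le,
            ENNReal.ofReal_natCast]
  · obtain ⟨C, hC⟩ := exists_measure_log_privateBelief_sub_ge_le hW hconn hv hq₀_pos hL
      hbdd i θM k θM
    refine limsup_logRate_le (M := 1) (C := C) one_pos ?_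
    filter_upwards [eventually_gt_atTop 0, hlarge C] with t ht htC
    rw [one_mul]
    refine (measure_mono fun ω hω => ?_).trans (hC t (t * ε - C) (by linarith))
    have hω : O.rejectionRate W q₀ i k t ω ≤ O.networkDivergence v θM k - ε := hω
    have h1 := mul_le_mul_of_nonneg_left hω (Nat.cast_nonneg (α := ℝ) t)
    rw [hrate t ω ht] at h1
    have hle : O.privateBelief W q₀ ω t i θM ≤ 1 := by
      rw [← sum_privateBelief (O := O) (W := W) (ω := ω) hq₀ t i]
      exact Finset.single_le_sum (fun b _ => (privateBelief_pos hq₀_pos t i b).le)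
        (Finset.mem_univ θM)
    have h2 := Real.log_nonpos (privateBelief_pos hq₀_pos t i θM).le hle
    simp only [Set.mem_ofPred_eq, networkDivergence_self, mul_sub] at h1 ⊢
    linarith
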